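/- Let $\mathcal H$ be a real Hilbert space. For $f:\mathcal H\to\mathbb R\cup\{\pm\infty\}$ let $\partial f(x)=\{v: f(y)\ge f(x)+\langle v,y-x\rangle\ \forall y\in\mathcal H\}$. For $0\le\mu<\infty$ and $0<L\le\infty$ let $\mathcal F_{\mu,L}$ be the set of convex, closed, proper functions on $\mathcal H$ that are $\mu$-strongly convex (no condition if $\mu=0$) and $L$-smooth, i.e. finite and differentiable everywhere with $L$-Lipschitz gradient (no condition if $L=\infty$). For a multi-valued operator $A$ on $\mathcal H$ let $J_{\alpha A}=(I+\alpha A)^{-1}$ be its resolvent, and let $$T_{A,B,C,\alpha,\lambda}=I-\lambda J_{\alpha B}+\lambda J_{\alpha A}\,(2J_{\alpha B}-I-\alpha C J_{\alpha B})$$ be the Davis–Yin splitting (DYS) operator. Let $0<L_f<\infty$, $0\le\mu_g<\infty$, $0\le\mu_h\le L_h<\infty$, $L_h>0$ and $\alpha\in(0,2/L_h)$, and let $f\in\mathcal F_{0,L_f}$, $g\in\mathcal F_{\mu_g,\infty}$ and $h\in\mathcal F_{\mu_h,L_h}$. Put $d=\max\{|1-\alpha\mu_h|,|1-\alpha L_h|\}$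 and let $\rho_{\rm new}\ge 0$ be given by $$\rho_{\rm new}^2=\max\left\{\frac{d^2}{1+2\alpha\mu_g},\ \frac{1}{(1+\alpha L_f)^2}\left(\alpha^2L_f^2+\frac{d^2}{1+2\alpha\mu_g}\right)\right\}.$$ Then $T=T_{\partial f,\partial g,\nabla h,\alpha,1}$ (where $\nabla h=\partial h$) is an everywhere defined, single-valued operator on $\mathcal H$ with $$\|Tx-Ty\|\le\rho_{\rm new}\|x-y\|\qquad\text{for all }x,y\in\mathcal H ,$$ and if $\mu_g>0$ or $\mu_h>0$, then $\rho_{\rm new}<1$. That is, $T$ is $\rho_{\rm new}$-contractive. -/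

import Mathlib

/-! Multi-valued operators on a set `H`, encoded as maps `H → Set H`. -/

namespace DYS

section Operators

variable {H : Type*}

/-- The inverse operator: `x ∈ A⁻¹ u` iff `u ∈ A x`. -/
def opInv (A : H → Set H) : H → Set H := fun u => {x | u ∈ A x}

/-- The identity operator. -/
def opId : H → Set H := fun x => {x}

/-- The composition `A B`. -/
def opComp (A B : H → Set H) : H → Set H := fun x => {s | ∃ u ∈ B x, s ∈ A u}

/-- The sum `A + B`. -/
def opAdd [Add H] (A B : H → Set H) : H → Set H :=
  fun x => {w | ∃ u ∈ A x, ∃ v ∈ B x, w = u + v}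

/-- The scalar multiple `c A`. -/
def opSMul [SMul ℝ H] (c : ℝ) (A : H → Set H) : H → Set H :=
  fun x => {w | ∃ u ∈ A x, w = c • u}

/-- The resolvent `J_{α A} = (I + α A)⁻¹`. -/
def opResolvent [Add H] [SMul ℝ H] (α : ℝ) (A : H → Set H) : H → Set H :=
  opInv (opAdd opId (opSMul α A))

/-- The Davis-Yin splitting operator
`I - lam J_{α B} + lam J_{α A} (2 J_{α B} - I - α C J_{α B})`. -/
def dysOperator [Add H] [SMul ℝ H] (A B C : H → Set H) (α lam : ℝ) : H → Set H :=
  opAdd (opAdd opId (opSMul (-lam) (opResolvent α B)))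
    (opSMul lam (opComp (opResolvent α A)
      (opAdd (opAdd (opSMul 2 (opResolvent α B)) (opSMul (-1) opId))
        (opSMul (-α) (opComp C (opResolvent α B))))))

/-- `A` is Lipschitz with constant `ρ` on its domain. -/
def IsLipschitzOp [NormedAddCommGroup H] (ρ : ℝ) (A : H → Set H) : Prop :=
  ∀ x y u v : H, u ∈ A x → v ∈ A y → ‖u - v‖ ≤ ρ * ‖x - y‖

end Operators

section Functions

variable {H : Type*} [NormedAddCommGroup H] [InnerProductSpace ℝ H]

/-- The subdifferential of an extended real-valued function. -/
def subdifferential (f : H → EReal) : H → Set H :=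
  fun x => {g | ∀ y : H, f x + ((inner ℝ g (y - x) : ℝ) : EReal) ≤ f y}

/-- The epigraph of `f`, a subset of `H × ℝ`. -/
def epigraph (f : H → EReal) : Set (H × ℝ) := {p | f p.1 ≤ (p.2 : EReal)}

/-- Convex, closed and proper functions. -/
structure IsCCP (f : H → EReal) : Prop where
  convex : Convex ℝ (epigraph f)
  closed : IsClosed (epigraph f)
  ne_bot : ∀ x, f x ≠ ⊥
  exists_ne_top : ∃ x, f x ≠ ⊤

/-- `μ`-strong convexity of an extended real-valued function. -/
def IsStronglyConvex (μ : ℝ) (f : H → EReal) : Prop :=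
  ∀ (x y : H) (a b : ℝ), 0 < a → 0 < b → a + b = 1 →
    f (a • x + b • y) + ((a * b * (μ / 2) * ‖x - y‖ ^ 2 : ℝ) : EReal)
      ≤ (a : EReal) * f x + (b : EReal) * f y

/-- `L`-smoothness: `f` is finite everywhere and differentiable, with an `L`-Lipschitz gradient. -/
def IsSmooth [CompleteSpace H] (L : ℝ) (f : H → EReal) : Prop :=
  ∃ φ : H → ℝ, (∀ x, f x = (φ x : EReal)) ∧ Differentiable ℝ φ ∧
    ∀ x y, ‖gradient φ x - gradient φ y‖ ≤ L * ‖x - y‖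

/-- The class `F_{μ, L}`, for `0 ≤ μ < ∞` and `0 < L ≤ ∞`: convex closed proper functions that are
`μ`-strongly convex if `μ > 0` and `L`-smooth if `L < ∞`. -/
def functionClass [CompleteSpace H] (μ : ℝ) (L : WithTop ℝ) : Set (H → EReal) :=
  {f | IsCCP f ∧ (0 < μ → IsStronglyConvex μ f) ∧ ∀ l : ℝ, L = (l : WithTop ℝ) → IsSmooth l f}

end Functions

end DYS

open Filter Topology

namespace DYS

/-! ### Elementwise form of resolvents and of the splitting operator. -/

section Resolvents

variable {H : Type*}

/-! Write `b, u, c, v` for the differences, between two inputs, of the backward point and of the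
chosen elements of `∂g`, `∇h`, `∂f`. Then `x - y = b + αu` and `Tx - Ty = e - q`, with `e = b - αc`
and `q = αv`. Strong monotonicity of `∂g` gives `‖x - y‖² ≥ m + ‖αu‖²` with `m = (1 + 2αμg)‖b‖²`.
The forward step for `h` gives `‖e‖ ≤ d‖b‖`, so `‖e‖² ≤ D m` with `D = d²/(1 + 2αμg)`. Cocoercivity
of `∂f` gives `‖q‖² ≤ αLf ⟪q, e - αu - q⟫`. The bound `norm_sub_sq_le_of_cocoercive` combines these
three facts by sums of squares.

Single-valuedness follows from monotonicity. Everywhere-definedness amounts to existence of proximal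
points, which completeness and the parallelogram law provide. -/

theorem mem_opResolvent [AddCommGroup H] [Module ℝ H] {α : ℝ} {A : H → Set H} {x p : H} :
    p ∈ opResolvent α A x ↔ ∃ a ∈ A p, x = p + α • a := by
  constructor
  · rintro ⟨_, rfl, _, ⟨a, ha, rfl⟩, h⟩
    exact ⟨a, ha, h⟩
  · rintro ⟨a, ha, h⟩
    exact ⟨p, rfl, _, ⟨a, ha, rfl⟩, h⟩

/-- The set-valued formula chooses an element of `J_{αB} x` at each of three occurrences; uniqueness
forces these choices to agree. -/
theorem mem_dysOperator_one [AddCommGroup H] [Module ℝ H] {α : ℝ} {A B C : H → Set H} {x t : H}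
    (hB : (opResolvent α B x).Subsingleton) :
    t ∈ dysOperator A B C α 1 x ↔ ∃ b ∈ opResolvent α B x, ∃ c ∈ C b,
      ∃ a ∈ opResolvent α A ((2 : ℝ) • b - x - α • c), t = x - b + a := by
  constructor
  · rintro ⟨_, ⟨_, rfl, _, ⟨b, hb, rfl⟩, rfl⟩, _,
      ⟨a, ⟨_, ⟨_, ⟨_, ⟨b', hb', rfl⟩, _, ⟨_, rfl, rfl⟩, rfl⟩, _, ⟨c, ⟨b'', hb'', hc⟩, rfl⟩, rfl⟩,
        ha⟩, rfl⟩, rfl⟩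
    obtain rfl := hB hb hb'
    obtain rfl := hB hb hb''
    refine ⟨b, hb, c, hc, a, ?_, by module⟩
    convert ha using 2
    module
  · rintro ⟨b, hb, c, hc, a, ha, rfl⟩
    refine ⟨_, ⟨x, rfl, _, ⟨b, hb, rfl⟩, rfl⟩, _,
      ⟨a, ⟨_, ⟨_, ⟨_, ⟨b, hb, rfl⟩, _, ⟨x, rfl, rfl⟩, rfl⟩, _, ⟨c, ⟨b, hb, hc⟩, rfl⟩, rfl⟩,
        ?_⟩, rfl⟩, by module⟩
    convert ha using 2
    module

end Resolvents

/-! ### Proximal points and strong monotonicity of subdifferentials. -/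

section Subdifferentials

variable {H : Type*} [NormedAddCommGroup H] [InnerProductSpace ℝ H]

theorem le_of_forall_small_mul_le {a b c : ℝ} (h : ∀ t : ℝ, 0 < t → t < 1 → a ≤ b + t * c) :
    a ≤ b := by
  have h1 : Tendsto (fun t : ℝ => b + t * c) (𝓝[>] 0) (𝓝 (b + 0 * c)) :=
    ((by fun_prop : Continuous fun t : ℝ => b + t * c).tendsto 0).mono_left nhdsWithin_le_nhds
  rw [zero_mul, add_zero] at h1
  refine ge_of_tendsto h1 ?_
  filter_upwards [Ioo_mem_nhdsGT (zero_lt_one' ℝ)] with t ht using h t ht.1 ht.2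

/-- Separate the epigraph from a point just below the graph; the separating functional has positive
vertical component, so its hyperplane is the graph of an affine function. -/
theorem IsCCP.exists_affine_minorant {g : H → EReal} (hg : IsCCP g) :
    ∃ (l : H →L[ℝ] ℝ) (k : ℝ), ∀ p ∈ epigraph g, k + l p.1 ≤ p.2 := by
  obtain ⟨x₀, hx₀⟩ := hg.exists_ne_top
  lift g x₀ to ℝ using ⟨hx₀, hg.ne_bot x₀⟩ with r₀ hr₀
  have hn : (x₀, r₀ - 1) ∉ epigraph g := by
    intro h
    change g x₀ ≤ ((r₀ - 1 : ℝ) : EReal) at h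
    rw [← hr₀, EReal.coe_le_coe_iff] at h
    linarith
  have hm : (x₀, r₀) ∈ epigraph g := by
    change g x₀ ≤ (r₀ : EReal)
    rw [← hr₀]
  obtain ⟨F, u, hu, hF⟩ := geometric_hahn_banach_point_closed hg.convex hg.closed hn
  have hdec : ∀ (y : H) (r : ℝ), F (y, r) = F (y, 0) + r * F (0, 1) := by
    intro y r
    rw [← smul_eq_mul, ← map_smul, ← map_add]
    simp
  have hc : 0 < F (0, 1) := by
    have h1 := hF _ hm
    rw [hdec] at hu h1
    linarith
  refine ⟨-(F (0, 1))⁻¹ • F.comp (ContinuousLinearMap.inl ℝ H ℝ), u / F (0, 1), ?_⟩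
  rintro ⟨y, r⟩ hp
  have h1 := hF _ hp
  rw [hdec] at h1
  have h2 : u / F (0, 1) + -(F (0, 1))⁻¹ * F (y, 0) = (u - F (y, 0)) / F (0, 1) := by
    field_simp
    ring
  simp only [smul_apply, ContinuousLinearMap.comp_apply,
    ContinuousLinearMap.inl_apply, smul_eq_mul]
  rw [h2, div_le_iff₀ hc]
  linarith

/-- The affine minorant bounds the objective below, and its quadratic term makes every minimizing
sequence Cauchy. -/
theorem IsCCP.exists_isLeast_prox [CompleteSpace H] {g : H → EReal} (hg : IsCCP g) {α : ℝ}
    (hα : 0 < α) (x : H) :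
    ∃ p ∈ epigraph g, ∀ q ∈ epigraph g,
      p.2 + ‖p.1 - x‖ ^ 2 / (2 * α) ≤ q.2 + ‖q.1 - x‖ ^ 2 / (2 * α) := by
  set V : H × ℝ → ℝ := fun q => q.2 + ‖q.1 - x‖ ^ 2 / (2 * α) with hV
  have hne : (V '' epigraph g).Nonempty := by
    obtain ⟨x₀, hx₀⟩ := hg.exists_ne_top
    exact Set.Nonempty.image _ ⟨(x₀, (g x₀).toReal), EReal.le_coe_toReal hx₀⟩
  have hbdd : BddBelow (V '' epigraph g) := by
    obtain ⟨l, k, hl⟩ := hg.exists_affine_minorant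
    refine ⟨k + l x - α * ‖l‖ ^ 2 / 2, ?_⟩
    rintro _ ⟨q, hq, rfl⟩
    have h1 := hl q hq
    have h2 : -(‖l‖ * ‖q.1 - x‖) ≤ l (q.1 - x) :=
      neg_le_of_neg_le (((neg_le_abs _).trans (l.le_opNorm _)))
    rw [map_sub] at h2
    have h3 : ‖q.1 - x‖ ^ 2 / (2 * α) - ‖l‖ * ‖q.1 - x‖ + α * ‖l‖ ^ 2 / 2
        = (‖q.1 - x‖ - α * ‖l‖) ^ 2 / (2 * α) := by
      field_simp
      ring
    have h4 : 0 ≤ (‖q.1 - x‖ - α * ‖l‖) ^ 2 / (2 * α) := by positivity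
    simp only [hV]
    linarith
  set I := sInf (V '' epigraph g) with hI
  have hle : ∀ q ∈ epigraph g, I ≤ V q := fun q hq => csInf_le hbdd ⟨q, hq, rfl⟩
  have hseq : ∀ n : ℕ, ∃ q ∈ epigraph g, V q < I + 1 / ((n : ℝ) + 1) := by
    intro n
    obtain ⟨_, ⟨q, hq, rfl⟩, h⟩ := exists_lt_of_csInf_lt hne
      (show sInf (V '' epigraph g) < I + 1 / ((n : ℝ) + 1) by
        rw [← hI]
        have : 0 < 1 / ((n : ℝ) + 1) := by positivity
        linarith)
    exact ⟨q, hq, h⟩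
  choose q hq hqV using hseq
  -- Parallelogram law: the objective at the midpoint drops below the average by `‖·‖²/(8α)`, yet
  -- stays at least `I`.
  have hmid : ∀ m n, ‖(q m).1 - (q n).1‖ ^ 2
      ≤ 4 * α * (1 / ((m : ℝ) + 1) + 1 / ((n : ℝ) + 1)) := by
    intro m n
    have h1 := hle _ (hg.convex (hq m) (hq n) (by norm_num : (0 : ℝ) ≤ 1 / 2)
      (by norm_num : (0 : ℝ) ≤ 1 / 2) (by norm_num))
    have h2 : ‖((1 / 2 : ℝ) • q m + (1 / 2 : ℝ) • q n).1 - x‖ ^ 2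
        = (‖(q m).1 - x‖ ^ 2 + ‖(q n).1 - x‖ ^ 2) / 2 - ‖(q m).1 - (q n).1‖ ^ 2 / 4 := by
      have e1 : ((1 / 2 : ℝ) • q m + (1 / 2 : ℝ) • q n).1 - x
          = (1 / 2 : ℝ) • (((q m).1 - x) + ((q n).1 - x)) := by
        simp only [Prod.fst_add, Prod.smul_fst]
        module
      have e2 : (q m).1 - (q n).1 = ((q m).1 - x) - ((q n).1 - x) := by abel
      rw [e1, e2, norm_smul, mul_pow, norm_add_sq_real, norm_sub_sq_real ((q m).1 - x)]
      norm_num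
      ring
    have h3 := hqV m
    have h4 := hqV n
    have h5 : V ((1 / 2 : ℝ) • q m + (1 / 2 : ℝ) • q n)
        = (V (q m) + V (q n)) / 2 - ‖(q m).1 - (q n).1‖ ^ 2 / (8 * α) := by
      simp only [hV]
      rw [h2]
      simp only [Prod.snd_add, Prod.smul_snd, smul_eq_mul]
      field_simp
      ring
    rw [h5] at h1
    have h6 : ‖(q m).1 - (q n).1‖ ^ 2 / (8 * α)
        ≤ (1 / ((m : ℝ) + 1) + 1 / ((n : ℝ) + 1)) / 2 := by linarith
    rw [div_le_iff₀ (by positivity)] at h6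
    linarith
  have hcau : CauchySeq fun n => (q n).1 := by
    refine cauchySeq_of_le_tendsto_0 (fun N : ℕ => Real.sqrt (4 * α * (2 * (1 / ((N : ℝ) + 1)))))
      ?_ ?_
    · intro m n N hm hn
      rw [dist_eq_norm]
      refine Real.le_sqrt_of_sq_le ((hmid m n).trans ?_)
      have h1 : 1 / ((m : ℝ) + 1) ≤ 1 / ((N : ℝ) + 1) := Nat.one_div_le_one_div hm
      have h2 : 1 / ((n : ℝ) + 1) ≤ 1 / ((N : ℝ) + 1) := Nat.one_div_le_one_div hn
      gcongr
      linarith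
    · have h := ((tendsto_one_div_add_atTop_nhds_zero_nat (𝕜 := ℝ)).const_mul 2).const_mul (4 * α)
      simpa using h.sqrt
  obtain ⟨p, hp⟩ := cauchySeq_tendsto_of_complete hcau
  have hVlim : Tendsto (fun n => V (q n)) atTop (𝓝 I) := by
    refine tendsto_of_tendsto_of_tendsto_of_le_of_le tendsto_const_nhds
      (?_ : Tendsto (fun n : ℕ => I + 1 / ((n : ℝ) + 1)) atTop (𝓝 I))
      (fun n => hle _ (hq n)) (fun n => (hqV n).le)
    simpa using (tendsto_one_div_add_atTop_nhds_zero_nat (𝕜 := ℝ)).const_add I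
  -- The heights converge because objective and quadratic term do, so closedness of the epigraph
  -- applies to the limit pair.
  have hrlim : Tendsto (fun n => (q n).2) atTop (𝓝 (I - ‖p - x‖ ^ 2 / (2 * α))) := by
    have h := hVlim.sub (((hp.sub_const x).norm.pow 2).div_const (2 * α))
    refine h.congr fun n => ?_
    simp only [hV]
    ring
  refine ⟨(p, I - ‖p - x‖ ^ 2 / (2 * α)),
    hg.closed.mem_of_tendsto (hp.prodMk_nhds hrlim) (Eventually.of_forall hq), fun y hy => ?_⟩
  have := hle y hy
  simp only [hV] at this
  simpa using this

/-- First-order optimality: compare the minimizer with points on the segment towards `y`, divide by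
`t`, and let `t → 0`. -/
theorem IsCCP.exists_mem_opResolvent [CompleteSpace H] {g : H → EReal} (hg : IsCCP g) {α : ℝ}
    (hα : 0 < α) (x : H) : ∃ p, p ∈ opResolvent α (subdifferential g) x := by
  obtain ⟨⟨p, r⟩, hp, hmin⟩ := hg.exists_isLeast_prox hα x
  refine ⟨p, mem_opResolvent.2 ⟨α⁻¹ • (x - p), fun y => ?_, ?_⟩⟩
  · have key : ∀ s : ℝ, (y, s) ∈ epigraph g → r + inner ℝ (α⁻¹ • (x - p)) (y - p) ≤ s := by
      intro s hs
      refine le_of_forall_small_mul_le (c := ‖y - p‖ ^ 2 / (2 * α)) fun t ht ht1 => ?_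
      have h1 := hmin _ (hg.convex hp hs (sub_nonneg.2 ht1.le) ht.le (by ring))
      have e1 : ((1 - t) • (p, r) + t • (y, s)).1 - x = (p - x) + t • (y - p) := by
        simp only [Prod.fst_add, Prod.smul_fst]
        module
      rw [e1, norm_add_sq_real, inner_smul_right, norm_smul, mul_pow, Real.norm_eq_abs,
        sq_abs] at h1
      simp only [Prod.snd_add, Prod.smul_snd, smul_eq_mul] at h1
      have e2 : inner ℝ (p - x) (y - p) = -inner ℝ (x - p) (y - p) := by
        rw [← inner_neg_left, neg_sub]
      rw [e2] at h1
      rw [real_inner_smul_left]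
      have h2 : t * (r + α⁻¹ * inner ℝ (x - p) (y - p))
          ≤ t * (s + t * (‖y - p‖ ^ 2 / (2 * α))) := by
        have e3 : (‖p - x‖ ^ 2 + 2 * (t * -inner ℝ (x - p) (y - p)) + t ^ 2 * ‖y - p‖ ^ 2)
            / (2 * α) = ‖p - x‖ ^ 2 / (2 * α) - t * (α⁻¹ * inner ℝ (x - p) (y - p))
              + t * (t * (‖y - p‖ ^ 2 / (2 * α))) := by
          field_simp
          ring
        rw [e3] at h1
        linarith
      exact le_of_mul_le_mul_left h2 ht
    rcases eq_or_ne (g y) ⊤ with hy | hy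
    · rw [hy]
      exact le_top
    · have h1 := key (g y).toReal (EReal.le_coe_toReal hy)
      calc g p + ((inner ℝ (α⁻¹ • (x - p)) (y - p) : ℝ) : EReal)
          ≤ (r : EReal) + ((inner ℝ (α⁻¹ • (x - p)) (y - p) : ℝ) : EReal) :=
            add_le_add_left hp _
        _ ≤ ((g y).toReal : EReal) := by exact_mod_cast h1
        _ = g y := EReal.coe_toReal hy (hg.ne_bot y)
  · rw [smul_inv_smul₀ hα.ne']
    abel

theorem IsCCP.isStronglyConvex_zero {g : H → EReal} (hg : IsCCP g) : IsStronglyConvex 0 g := by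
  intro x y a b ha hb hab
  have mul_ne_bot : ∀ {c : ℝ} {z : EReal}, 0 < c → z ≠ ⊥ → (c : EReal) * z ≠ ⊥ := by
    intro c z hc hz
    induction z with
    | bot => exact absurd rfl hz
    | coe z => exact EReal.coe_ne_bot (c * z)
    | top => simp [EReal.coe_mul_top_of_pos hc]
  rcases eq_or_ne (g x) ⊤ with hx | hx
  · rw [hx, EReal.coe_mul_top_of_pos ha, EReal.top_add_of_ne_bot]
    · exact le_top
    · exact mul_ne_bot hb (hg.ne_bot y)
  rcases eq_or_ne (g y) ⊤ with hy | hy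
  · rw [hy, EReal.coe_mul_top_of_pos hb, EReal.add_top_of_ne_bot]
    · exact le_top
    · exact mul_ne_bot ha (hg.ne_bot x)
  have h := hg.convex (show (x, (g x).toReal) ∈ epigraph g from EReal.le_coe_toReal hx)
    (show (y, (g y).toReal) ∈ epigraph g from EReal.le_coe_toReal hy) ha.le hb.le hab
  change g (a • x + b • y) ≤ ((a * (g x).toReal + b * (g y).toReal : ℝ) : EReal) at h
  rw [EReal.coe_add, EReal.coe_mul, EReal.coe_mul, EReal.coe_toReal hx (hg.ne_bot x),
    EReal.coe_toReal hy (hg.ne_bot y)] at h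
  simpa using h

theorem IsCCP.ne_top_of_mem_subdifferential {g : H → EReal} (hg : IsCCP g) {x u : H}
    (hu : u ∈ subdifferential g x) : g x ≠ ⊤ := by
  intro hx
  obtain ⟨y, hy⟩ := hg.exists_ne_top
  have := hu y
  rw [hx, EReal.top_add_coe] at this
  exact hy (top_le_iff.1 this)

theorem IsStronglyConvex.le_of_mem_subdifferential {g : H → EReal} {μ : ℝ}
    (hs : IsStronglyConvex μ g) {x y u : H} {r s : ℝ} (hx : g x = r) (hy : g y = s)
    (hu : u ∈ subdifferential g x) : r + inner ℝ u (y - x) + μ / 2 * ‖y - x‖ ^ 2 ≤ s := by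
  refine le_of_forall_small_mul_le (c := μ / 2 * ‖y - x‖ ^ 2) fun t ht ht1 => ?_
  have h1 := hs x y (1 - t) t (sub_pos.2 ht1) ht (by ring)
  have h2 := hu ((1 - t) • x + t • y)
  have e1 : (1 - t) • x + t • y - x = t • (y - x) := by module
  rw [e1, inner_smul_right, hx] at h2
  rw [hx, hy, norm_sub_rev] at h1
  have h3 := (add_le_add_left h2 _).trans h1
  norm_cast at h3
  have h4 : t * (r + inner ℝ u (y - x) + μ / 2 * ‖y - x‖ ^ 2)
      ≤ t * (s + t * (μ / 2 * ‖y - x‖ ^ 2)) := by linarith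
  exact le_of_mul_le_mul_left h4 ht

theorem IsCCP.strongly_monotone_subdifferential {g : H → EReal} (hg : IsCCP g) {μ : ℝ}
    (hs : IsStronglyConvex μ g) {x y u v : H} (hu : u ∈ subdifferential g x)
    (hv : v ∈ subdifferential g y) : μ * ‖x - y‖ ^ 2 ≤ inner ℝ (u - v) (x - y) := by
  have hx := EReal.coe_toReal (hg.ne_top_of_mem_subdifferential hu) (hg.ne_bot x)
  have hy := EReal.coe_toReal (hg.ne_top_of_mem_subdifferential hv) (hg.ne_bot y)
  have h1 := hs.le_of_mem_subdifferential hx.symm hy.symm hu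
  have h2 := hs.le_of_mem_subdifferential hy.symm hx.symm hv
  have e : inner ℝ u (y - x) = -inner ℝ u (x - y) := by rw [← inner_neg_right, neg_sub]
  rw [norm_sub_rev y x, e] at h1
  rw [inner_sub_left]
  linarith

theorem IsCCP.subsingleton_opResolvent {g : H → EReal} (hg : IsCCP g) {α : ℝ} (hα : 0 < α)
    (x : H) : (opResolvent α (subdifferential g) x).Subsingleton := by
  intro p hp q hq
  obtain ⟨a, ha, hpa⟩ := mem_opResolvent.1 hp
  obtain ⟨b, hb, hqb⟩ := mem_opResolvent.1 hq
  have h := hg.strongly_monotone_subdifferential hg.isStronglyConvex_zero ha hb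
  have e : p - q = -α • (a - b) := by
    have : p + α • a = q + α • b := hpa.symm.trans hqb
    calc p - q = (p + α • a) - q - α • a := by abel
      _ = -α • (a - b) := by
        rw [this]
        module
  rw [zero_mul] at h
  have h1 : ‖p - q‖ ^ 2 = -α * inner ℝ (a - b) (p - q) := by
    rw [← real_inner_self_eq_norm_sq]
    nth_rw 1 [e]
    rw [real_inner_smul_left]
  have h2 : ‖p - q‖ ^ 2 ≤ 0 := by
    rw [h1]
    nlinarith
  have h3 : ‖p - q‖ = 0 := by nlinarith [norm_nonneg (p - q)]
  exact sub_eq_zero.1 (norm_eq_zero.1 h3)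

end Subdifferentials

/-! ### Gradients and cocoercivity (Baillon–Haddad). -/

section Smooth

variable {H : Type*} [NormedAddCommGroup H] [InnerProductSpace ℝ H]

/-- Evaluate the lower bound based at `x` and the upper bound based at `y` at `y + t(Gx - Gy)`, then
add the version with `x, y` swapped. The best choice is `t = 1/M`. -/
theorem norm_sq_le_mul_inner_of_quadratic_bounds {φ : H → ℝ} {G : H → H} {M : ℝ} (hM : 0 ≤ M)
    (hl : ∀ x y, φ x + inner ℝ (G x) (y - x) ≤ φ y)
    (hu : ∀ x y, φ y ≤ φ x + inner ℝ (G x) (y - x) + M / 2 * ‖y - x‖ ^ 2) (x y : H) :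
    ‖G x - G y‖ ^ 2 ≤ M * inner ℝ (G x - G y) (x - y) := by
  have key : ∀ x y : H, ∀ t : ℝ, (t - M / 2 * t ^ 2) * ‖G x - G y‖ ^ 2
      ≤ φ y - φ x - inner ℝ (G x) (y - x) := by
    intro x y t
    have h1 := hl x (y + t • (G x - G y))
    have h2 := hu y (y + t • (G x - G y))
    rw [add_sub_cancel_left, inner_smul_right, norm_smul, mul_pow, Real.norm_eq_abs, sq_abs] at h2
    rw [add_sub_right_comm, inner_add_right, inner_smul_right] at h1
    have h3 : ‖G x - G y‖ ^ 2 = inner ℝ (G x) (G x - G y) - inner ℝ (G y) (G x - G y) := by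
      rw [← inner_sub_left, real_inner_self_eq_norm_sq]
    have h4 : t * ‖G x - G y‖ ^ 2
        = t * inner ℝ (G x) (G x - G y) - t * inner ℝ (G y) (G x - G y) := by
      rw [h3]
      ring
    linarith
  have sym : ∀ t : ℝ, (2 * t - M * t ^ 2) * ‖G x - G y‖ ^ 2 ≤ inner ℝ (G x - G y) (x - y) := by
    intro t
    have h1 := key x y t
    have h2 := key y x t
    rw [norm_sub_rev (G y) (G x)] at h2
    have e : inner ℝ (G x) (y - x) = -inner ℝ (G x) (x - y) := by rw [← inner_neg_right, neg_sub]
    rw [inner_sub_left]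
    linarith
  rcases hM.eq_or_lt with rfl | hM
  -- For `M = 0` the bound is linear in `t`, so a large `t` violates it unless `Gx = Gy`.
  · rw [zero_mul]
    by_contra! h
    have h1 := sym ((inner ℝ (G x - G y) (x - y) + 1) / (2 * ‖G x - G y‖ ^ 2))
    have h2 : (2 * ((inner ℝ (G x - G y) (x - y) + 1) / (2 * ‖G x - G y‖ ^ 2)) - 0 *
      ((inner ℝ (G x - G y) (x - y) + 1) / (2 * ‖G x - G y‖ ^ 2)) ^ 2) * ‖G x - G y‖ ^ 2
        = inner ℝ (G x - G y) (x - y) + 1 := by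
      generalize ‖G x - G y‖ ^ 2 = N at *
      field_simp
      ring
    linarith
  · have h1 := sym (1 / M)
    have h2 : (2 * (1 / M) - M * (1 / M) ^ 2) * ‖G x - G y‖ ^ 2 = ‖G x - G y‖ ^ 2 / M := by
      field_simp
      ring
    rw [h2, div_le_iff₀ hM] at h1
    linarith

variable [CompleteSpace H]

theorem hasDerivAt_comp_line {φ : H → ℝ} (hφ : Differentiable ℝ φ) (x v : H) (t : ℝ) :
    HasDerivAt (fun s : ℝ => φ (x + s • v)) (inner ℝ (gradient φ (x + t • v)) v) t := by
  have h1 : HasDerivAt (fun s : ℝ => x + s • v) v t := by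
    simpa using ((hasDerivAt_id t).smul_const v).const_add x
  have h2 := (hφ (x + t • v)).hasGradientAt.hasFDerivAt.comp_hasDerivAt t h1
  rwa [InnerProductSpace.toDual_apply_apply] at h2

theorem le_quadratic_of_lipschitz_gradient {φ : H → ℝ} {L : ℝ} (hφ : Differentiable ℝ φ)
    (hL : ∀ x y, ‖gradient φ x - gradient φ y‖ ≤ L * ‖x - y‖) (x y : H) :
    φ y ≤ φ x + inner ℝ (gradient φ x) (y - x) + L / 2 * ‖y - x‖ ^ 2 := by
  have hd : ∀ t : ℝ, HasDerivAt (fun s : ℝ => φ (x + s • (y - x))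
      - s * inner ℝ (gradient φ x) (y - x) - L / 2 * ‖y - x‖ ^ 2 * s ^ 2)
      (inner ℝ (gradient φ (x + t • (y - x))) (y - x) - 1 * inner ℝ (gradient φ x) (y - x)
        - L / 2 * ‖y - x‖ ^ 2 * (2 * t)) t := by
    intro t
    refine ((hasDerivAt_comp_line hφ x (y - x) t).sub
      ((hasDerivAt_id t).mul_const _)).sub ?_
    simpa using (hasDerivAt_pow 2 t).const_mul (L / 2 * ‖y - x‖ ^ 2)
  have hanti : AntitoneOn (fun s : ℝ => φ (x + s • (y - x))
      - s * inner ℝ (gradient φ x) (y - x) - L / 2 * ‖y - x‖ ^ 2 * s ^ 2) (Set.Icc 0 1) := by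
    refine antitoneOn_of_deriv_nonpos (convex_Icc 0 1)
      (fun t _ => (hd t).continuousAt.continuousWithinAt)
      (fun t _ => (hd t).differentiableAt.differentiableWithinAt) fun t ht => ?_
    rw [interior_Icc] at ht
    rw [(hd t).deriv]
    have h1 := real_inner_le_norm (gradient φ (x + t • (y - x)) - gradient φ x) (y - x)
    have h2 := hL (x + t • (y - x)) x
    rw [add_sub_cancel_left, norm_smul, Real.norm_of_nonneg ht.1.le] at h2
    have h3 := mul_le_mul_of_nonneg_right h2 (norm_nonneg (y - x))
    rw [inner_sub_left] at h1
    linarith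
  have h := hanti (Set.left_mem_Icc.2 zero_le_one) (Set.right_mem_Icc.2 zero_le_one) zero_le_one
  simp only [one_smul, zero_smul, add_zero, add_sub_cancel] at h
  linarith

/-- Along the direction `v - ∇φ(x)`, `φ` minus its supporting affine function is minimal at `x`; the
vanishing derivative is `-‖v - ∇φ(x)‖²`. -/
theorem eq_gradient_of_mem_subdifferential {f : H → EReal} {φ : H → ℝ}
    (hf : ∀ x, f x = (φ x : EReal)) (hφ : Differentiable ℝ φ) {x v : H}
    (hv : v ∈ subdifferential f x) : v = gradient φ x := by
  have hge : ∀ y, φ x + inner ℝ v (y - x) ≤ φ y := by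
    intro y
    have := hv y
    rw [hf, hf] at this
    exact_mod_cast this
  have h1 : HasDerivAt (fun s : ℝ => φ (x + s • (v - gradient φ x))
      - s * inner ℝ v (v - gradient φ x))
      (inner ℝ (gradient φ (x + (0 : ℝ) • (v - gradient φ x))) (v - gradient φ x)
        - 1 * inner ℝ v (v - gradient φ x)) 0 :=
    (hasDerivAt_comp_line hφ x _ 0).sub ((hasDerivAt_id 0).mul_const _)
  have h2 : IsLocalMin (fun s : ℝ => φ (x + s • (v - gradient φ x))
      - s * inner ℝ v (v - gradient φ x)) 0 := by
    refine Eventually.of_forall fun s => ?_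
    have := hge (x + s • (v - gradient φ x))
    rw [add_sub_cancel_left, inner_smul_right] at this
    simp only [zero_smul, add_zero, zero_mul, sub_zero]
    linarith
  have h3 := h2.hasDerivAt_eq_zero h1
  rw [zero_smul, add_zero, one_mul, ← inner_sub_left, ← neg_sub v, inner_neg_left, neg_eq_zero,
    inner_self_eq_zero, sub_eq_zero] at h3
  exact h3

theorem IsCCP.gradient_mem_subdifferential {f : H → EReal} {φ : H → ℝ} (hc : IsCCP f)
    (hf : ∀ x, f x = (φ x : EReal)) (hφ : Differentiable ℝ φ) (x : H) :
    gradient φ x ∈ subdifferential f x := by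
  intro y
  rw [hf, hf]
  have h1 := (hasDerivAt_comp_line hφ x (y - x) 0).tendsto_slope_zero_right
  rw [zero_smul, add_zero] at h1
  have h2 : inner ℝ (gradient φ x) (y - x) ≤ φ y - φ x := by
    refine le_of_tendsto h1 ?_
    filter_upwards [Ioo_mem_nhdsGT (zero_lt_one' ℝ)] with t ht
    have h := hc.isStronglyConvex_zero x y (1 - t) t (sub_pos.2 ht.2) ht.1 (by ring)
    rw [hf, hf, hf] at h
    norm_cast at h
    have e1 : x + t • (y - x) = (1 - t) • x + t • y := by module
    simp only [zero_add, smul_eq_mul, e1]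
    rw [inv_mul_le_iff₀ ht.1]
    linarith
  have h3 : φ x + inner ℝ (gradient φ x) (y - x) ≤ φ y := by linarith
  exact_mod_cast h3

/-- Apply the previous cocoercivity to `φ - (μ/2)‖·‖²`, which is convex and has upper quadratic
constant `L - μ`. -/
theorem subdifferential_strongly_cocoercive {f : H → EReal} {μ L : ℝ} (hc : IsCCP f)
    (hs : IsStronglyConvex μ f) (hL : IsSmooth L f) (hμL : μ ≤ L) {x y u v : H}
    (hu : u ∈ subdifferential f x) (hv : v ∈ subdifferential f y) :
    ‖(u - v) - μ • (x - y)‖ ^ 2 ≤ (L - μ) * inner ℝ ((u - v) - μ • (x - y)) (x - y) := by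
  obtain ⟨φ, hf, hφ, hlip⟩ := hL
  have hid : ∀ a b : H, ‖b‖ ^ 2 = ‖a‖ ^ 2 + 2 * inner ℝ a (b - a) + ‖b - a‖ ^ 2 := by
    intro a b
    rw [← norm_add_sq_real, add_sub_cancel]
  have h := norm_sq_le_mul_inner_of_quadratic_bounds (φ := fun z => φ z - μ / 2 * ‖z‖ ^ 2)
    (G := fun z => gradient φ z - μ • z) (sub_nonneg.2 hμL)
    (fun a b => by
      have h1 := hs.le_of_mem_subdifferential (hf a) (hf b)
        (hc.gradient_mem_subdifferential hf hφ a)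
      have h2 := hid a b
      simp only [inner_sub_left, real_inner_smul_left]
      rw [h2]
      linarith)
    (fun a b => by
      have h1 := le_quadratic_of_lipschitz_gradient hφ hlip a b
      have h2 := hid a b
      simp only [inner_sub_left, real_inner_smul_left]
      rw [h2]
      linarith) x y
  rw [eq_gradient_of_mem_subdifferential hf hφ hu, eq_gradient_of_mem_subdifferential hf hφ hv]
  have e : gradient φ x - gradient φ y - μ • (x - y)
      = (gradient φ x - μ • x) - (gradient φ y - μ • y) := by module
  rw [e]
  exact h

end Smooth

/-! ### The norm inequalities behind the contraction factor. -/

section Estimates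

variable {H : Type*} [NormedAddCommGroup H] [InnerProductSpace ℝ H]

theorem norm_forward_step_le {μ L α : ℝ} (hμL : μ ≤ L) (hα : 0 < α) {b c : H}
    (h : ‖c - μ • b‖ ^ 2 ≤ (L - μ) * inner ℝ (c - μ • b) b) :
    ‖b - α • c‖ ≤ max |1 - α * μ| |1 - α * L| * ‖b‖ := by
  have hN := norm_nonneg b
  -- The hypothesis says that `c` lies in the ball with centre `((μ + L)/2) b` and radius `((L -
  -- μ)/2)‖b‖`.
  set w := c - ((μ + L) / 2) • b with hw
  have h1 : ‖w‖ ≤ (L - μ) / 2 * ‖b‖ := by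
    refine abs_le_of_sq_le_sq' ?_ (by nlinarith) |>.2
    have e : w = (c - μ • b) - ((L - μ) / 2) • b := by
      rw [hw]
      module
    rw [e, norm_sub_sq_real, inner_smul_right, norm_smul, mul_pow, Real.norm_eq_abs, sq_abs]
    nlinarith
  have e : b - α • c = (1 - α * ((μ + L) / 2)) • b - α • w := by
    rw [hw]
    module
  have h2 : ‖b - α • c‖ ≤ |1 - α * ((μ + L) / 2)| * ‖b‖ + α * ((L - μ) / 2 * ‖b‖) := by
    rw [e]
    refine (norm_sub_le _ _).trans ?_
    rw [norm_smul, norm_smul, Real.norm_eq_abs, Real.norm_of_nonneg hα.le]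
    gcongr
  refine h2.trans ?_
  rw [← mul_assoc, ← add_mul]
  refine mul_le_mul_of_nonneg_right ?_ hN
  rcases abs_cases (1 - α * ((μ + L) / 2)) with ⟨h3, _⟩ | ⟨h3, _⟩
  · refine le_max_of_le_left (le_trans ?_ (le_abs_self _))
    rw [h3]
    linarith
  · refine le_max_of_le_right (le_trans ?_ (neg_le_abs _))
    rw [h3]
    linarith

theorem norm_sub_sq_le_of_cocoercive {β D m : ℝ} (hβ : 0 < β) (hD : 0 ≤ D) (hm : 0 ≤ m)
    {e u q : H} (he : ‖e‖ ^ 2 ≤ D * m) (hq : ‖q‖ ^ 2 ≤ β * inner ℝ q (e - u - q)) :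
    ‖e - q‖ ^ 2 ≤ max D (1 / (1 + β) ^ 2 * (β ^ 2 + D)) * (m + ‖u‖ ^ 2) := by
  rw [inner_sub_right, inner_sub_right, real_inner_self_eq_norm_sq] at hq
  have hX : 0 ≤ m + ‖u‖ ^ 2 := by positivity
  have hsq : ∀ (v : H) (s : ℝ), 0 ≤ ‖v‖ ^ 2 + 2 * s * inner ℝ q v + s ^ 2 * ‖q‖ ^ 2 := by
    intro v s
    have h : ‖v + s • q‖ ^ 2 = ‖v‖ ^ 2 + 2 * s * inner ℝ q v + s ^ 2 * ‖q‖ ^ 2 := by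
      rw [norm_add_sq_real, inner_smul_right, norm_smul, mul_pow, Real.norm_eq_abs, sq_abs,
        real_inner_comm]
      ring
    rw [← h]
    positivity
  rw [norm_sub_sq_real, real_inner_comm q e]
  -- The two entries of the maximum coincide exactly at `D = β/(β + 2)`.
  rcases le_or_gt (β / (β + 2)) D with hDβ | hDβ
  · refine le_trans ?_ (mul_le_mul_of_nonneg_right (le_max_left _ _) hX)
    have h1 := hsq u ((β + 2) / β)
    have h2 := mul_le_mul_of_nonneg_right hDβ (sq_nonneg ‖u‖)
    have h3 := mul_nonneg (show 0 ≤ β / (β + 2) by positivity) h1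
    have h4 : β / (β + 2) * (‖u‖ ^ 2 + 2 * ((β + 2) / β) * inner ℝ q u
        + ((β + 2) / β) ^ 2 * ‖q‖ ^ 2)
        = β / (β + 2) * ‖u‖ ^ 2 + 2 * inner ℝ q u + ‖q‖ ^ 2 + 2 * (‖q‖ ^ 2 / β) := by
      field_simp
      ring
    have h5 : ‖q‖ ^ 2 / β ≤ inner ℝ q e - inner ℝ q u - ‖q‖ ^ 2 := by
      rw [div_le_iff₀ hβ]
      linarith
    linarith
  · refine le_trans ?_ (mul_le_mul_of_nonneg_right (le_max_right _ _) hX)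
    have hq' : ‖q‖ ^ 2 / β ≤ inner ℝ q e - inner ℝ q u - ‖q‖ ^ 2 := by
      rw [div_le_iff₀ hβ]
      linarith
    -- The multipliers of the general case divide by `D`; `D = 0` forces `e = 0`.
    rcases hD.eq_or_lt with rfl | hD
    · have he0 : e = 0 := by
        have : ‖e‖ = 0 := by nlinarith [norm_nonneg e]
        exact norm_eq_zero.1 this
      subst he0
      rw [inner_zero_right] at *
      have h1 := hsq u ((1 + β) / β)
      have h2 := mul_nonneg (show 0 ≤ 1 / (1 + β) ^ 2 * (β ^ 2 + 0) by positivity) h1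
      have h3 := mul_nonneg (show 0 ≤ 1 / (1 + β) ^ 2 * (β ^ 2 + 0) by positivity) hm
      have h4 : 1 / (1 + β) ^ 2 * (β ^ 2 + 0) * (‖u‖ ^ 2 + 2 * ((1 + β) / β) * inner ℝ q u
          + ((1 + β) / β) ^ 2 * ‖q‖ ^ 2)
          = 1 / (1 + β) ^ 2 * (β ^ 2 + 0) * ‖u‖ ^ 2 + 2 * β / (1 + β) * inner ℝ q u
            + ‖q‖ ^ 2 := by
        field_simp
        ring
      have h5 := mul_le_mul_of_nonneg_left hq' (show 0 ≤ 2 * β / (1 + β) by positivity)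
      have h6 : 2 * β / (1 + β) * (‖q‖ ^ 2 / β) = 2 * ‖q‖ ^ 2 - 2 * β / (1 + β) * ‖q‖ ^ 2 := by
        field_simp
        ring
      rw [norm_zero]
      linarith
    · have hK : 0 < β - D * (β + 2) := by
        rw [lt_div_iff₀ (by positivity)] at hDβ
        linarith
      have hγ : 0 < β - D := by nlinarith [mul_pos hD hβ]
      -- The gap is exactly the sum of two weighted squares and nonnegative multiples of the slacks
      -- in `hq'` and `he`.
      have h1 := mul_nonneg (show 0 ≤ 1 / (1 + β) ^ 2 * (β ^ 2 + D) by positivity)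
        (hsq u ((1 + β) / (β - D)))
      have h2 := mul_nonneg
        (show 0 ≤ β * (β - D * (β + 2)) / (D * (1 + β) ^ 2) by positivity)
        (hsq e (D * (1 + β) / (β * (β - D))))
      have h3 := mul_le_mul_of_nonneg_left hq'
        (show 0 ≤ 2 * ((β ^ 2 + D) / ((1 + β) * (β - D))) by positivity)
      have h4 := mul_le_mul_of_nonneg_left he
        (show 0 ≤ 1 / (1 + β) ^ 2 * (β ^ 2 + D) / D by positivity)
      generalize ‖q‖ ^ 2 = Q at *
      generalize ‖e‖ ^ 2 = E at *
      generalize ‖u‖ ^ 2 = U at *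
      generalize inner ℝ q e = s at *
      generalize inner ℝ q u = t at *
      rw [← sub_nonneg] at h3 h4 ⊢
      refine (add_nonneg (add_nonneg h1 h2) (add_nonneg h3 h4)).trans_eq ?_
      have hγ' := hγ.ne'
      field_simp
      ring

end Estimates

end DYS

/-! ### Assembly of the main theorem. -/

theorem corollary1 {H : Type*} [NormedAddCommGroup H] [InnerProductSpace ℝ H] [CompleteSpace H]
    (Lf μg μh Lh α : ℝ) (hLf : 0 < Lf) (hμg : 0 ≤ μg) (hμh : 0 ≤ μh) (hμL : μh ≤ Lh)
    (hLh : 0 < Lh) (hα : 0 < α) (hαL : α < 2 / Lh)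
    (f g h : H → EReal)
    (hf : f ∈ DYS.functionClass (H := H) 0 (Lf : WithTop ℝ))
    (hg : g ∈ DYS.functionClass (H := H) μg ⊤)
    (hh : h ∈ DYS.functionClass (H := H) μh (Lh : WithTop ℝ))
    (d ρ : ℝ)
    (hd : d = max |1 - α * μh| |1 - α * Lh|)
    (hρ : ρ = Real.sqrt (max (d ^ 2 / (1 + 2 * α * μg))
      (1 / (1 + α * Lf) ^ 2 * (α ^ 2 * Lf ^ 2 + d ^ 2 / (1 + 2 * α * μg))))) :
    -- the operator is everywhere defined and single-valued
    (∀ x : H, ∃! u : H, u ∈ DYS.dysOperator (DYS.subdifferential f) (DYS.subdifferential g)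
        (DYS.subdifferential h) α 1 x) ∧
    DYS.IsLipschitzOp ρ (DYS.dysOperator (DYS.subdifferential f) (DYS.subdifferential g)
        (DYS.subdifferential h) α 1) ∧
    (0 < μg ∨ 0 < μh → ρ < 1) := by
  obtain ⟨hfc, -, hfL⟩ := hf
  obtain ⟨hgc, hgs, -⟩ := hg
  obtain ⟨hhc, hhs, hhL⟩ := hh
  replace hfL := hfL Lf rfl
  replace hhL := hhL Lh rfl
  replace hgs : DYS.IsStronglyConvex μg g := by
    rcases hμg.eq_or_lt with rfl | h0
    exacts [hgc.isStronglyConvex_zero, hgs h0]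
  replace hhs : DYS.IsStronglyConvex μh h := by
    rcases hμh.eq_or_lt with rfl | h0
    exacts [hhc.isStronglyConvex_zero, hhs h0]
  have hmem := fun x t : H => DYS.mem_dysOperator_one (A := DYS.subdifferential f)
    (C := DYS.subdifferential h) (t := t) (hgc.subsingleton_opResolvent hα x)
  have hlip : DYS.IsLipschitzOp ρ (DYS.dysOperator (DYS.subdifferential f)
      (DYS.subdifferential g) (DYS.subdifferential h) α 1) := by
    intro x y t₁ t₂ ht₁ ht₂
    obtain ⟨b₁, hb₁, c₁, hc₁, a₁, ha₁, rfl⟩ := (hmem _ _).1 ht₁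
    obtain ⟨b₂, hb₂, c₂, hc₂, a₂, ha₂, rfl⟩ := (hmem _ _).1 ht₂
    obtain ⟨u₁, hu₁, hx⟩ := DYS.mem_opResolvent.1 hb₁
    obtain ⟨u₂, hu₂, hy⟩ := DYS.mem_opResolvent.1 hb₂
    obtain ⟨v₁, hv₁, hw₁⟩ := DYS.mem_opResolvent.1 ha₁
    obtain ⟨v₂, hv₂, hw₂⟩ := DYS.mem_opResolvent.1 ha₂
    have hu := hgc.strongly_monotone_subdifferential hgs hu₁ hu₂
    have hc := DYS.norm_forward_step_le hμL hα
      (DYS.subdifferential_strongly_cocoercive hhc hhs hhL hμL hc₁ hc₂)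
    have hv := DYS.subdifferential_strongly_cocoercive hfc hfc.isStronglyConvex_zero hfL hLf.le
      hv₁ hv₂
    rw [zero_smul, sub_zero, sub_zero] at hv
    rw [← hd] at hc
    have hxy : x - y = (b₁ - b₂) + α • (u₁ - u₂) := by
      rw [hx, hy]
      module
    have ha : a₁ - a₂ = (b₁ - b₂ - α • (c₁ - c₂)) - α • (u₁ - u₂) - α • (v₁ - v₂) := by
      rw [← sub_eq_iff_eq_add] at hw₁ hw₂
      rw [← hw₁, ← hw₂, hx, hy]
      module
    have hden : 0 < 1 + 2 * α * μg := by positivity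
    have hnorm : (1 + 2 * α * μg) * ‖b₁ - b₂‖ ^ 2 + ‖α • (u₁ - u₂)‖ ^ 2 ≤ ‖x - y‖ ^ 2 := by
      rw [hxy, norm_add_sq_real, inner_smul_right, real_inner_comm]
      have := mul_le_mul_of_nonneg_left hu hα.le
      linarith
    have hest := DYS.norm_sub_sq_le_of_cocoercive (β := α * Lf)
      (D := d ^ 2 / (1 + 2 * α * μg)) (m := (1 + 2 * α * μg) * ‖b₁ - b₂‖ ^ 2)
      (e := b₁ - b₂ - α • (c₁ - c₂)) (u := α • (u₁ - u₂)) (q := α • (v₁ - v₂))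
      (by positivity) (by positivity) (by positivity)
      (by
        rw [← mul_assoc, div_mul_cancel₀ _ hden.ne', ← mul_pow]
        gcongr)
      (by
        rw [← ha, norm_smul, mul_pow, Real.norm_eq_abs, sq_abs, real_inner_smul_left]
        have := mul_le_mul_of_nonneg_left hv (sq_nonneg α)
        linarith)
    have ht : x - b₁ + a₁ - (y - b₂ + a₂)
        = (b₁ - b₂ - α • (c₁ - c₂)) - α • (v₁ - v₂) := by
      have : x - b₁ + a₁ - (y - b₂ + a₂) = (x - y) - (b₁ - b₂) + (a₁ - a₂) := by abel
      rw [this, hxy, ha]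
      abel
    rw [ht, hρ]
    refine abs_le_of_sq_le_sq' ?_ (by positivity) |>.2
    rw [mul_pow, Real.sq_sqrt (le_max_of_le_left (by positivity)), ← mul_pow α Lf]
    refine hest.trans ?_
    gcongr
  refine ⟨fun x => ?_, hlip, fun hpos => ?_⟩
  · obtain ⟨φ, hφ, hφd, -⟩ := hhL
    obtain ⟨b, hb⟩ := hgc.exists_mem_opResolvent hα x
    obtain ⟨a, ha⟩ := hfc.exists_mem_opResolvent hα ((2 : ℝ) • b - x - α • gradient φ b)
    refine ⟨x - b + a, (hmem _ _).2
      ⟨b, hb, _, hhc.gradient_mem_subdifferential hφ hφd b, a, ha, rfl⟩, fun t ht => ?_⟩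
    obtain ⟨b', hb', c', hc', a', ha', rfl⟩ := (hmem _ _).1 ht
    obtain rfl := hgc.subsingleton_opResolvent hα x hb hb'
    obtain rfl := DYS.eq_gradient_of_mem_subdifferential hφ hφd hc'
    rw [hfc.subsingleton_opResolvent hα _ ha ha']
  · have hαL2 : α * Lh < 2 := (lt_div_iff₀ hLh).1 hαL
    have hαμ : α * μh ≤ α * Lh := mul_le_mul_of_nonneg_left hμL hα.le
    have hd0 : 0 ≤ d := hd ▸ le_max_of_le_left (abs_nonneg _)
    have hαLpos : 0 < α * Lh := by positivity
    have hαμ0 : 0 ≤ α * μh := by positivity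
    have hd1 : d ≤ 1 := by
      rw [hd]
      exact max_le (abs_le.2 ⟨by linarith, by linarith⟩) (abs_le.2 ⟨by linarith, by linarith⟩)
    have hD : d ^ 2 / (1 + 2 * α * μg) < 1 := by
      rw [div_lt_one (by positivity)]
      rcases hpos with hpos | hpos
      · have : 0 < α * μg := by positivity
        nlinarith
      · have hαμ1 : 0 < α * μh := by positivity
        have : d < 1 := by
          rw [hd]
          exact max_lt (abs_lt.2 ⟨by linarith, by linarith⟩) (abs_lt.2 ⟨by linarith, by linarith⟩)
        have : 0 ≤ α * μg := by positivity
        nlinarith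
    rw [hρ, Real.sqrt_lt' one_pos, one_pow]
    refine max_lt hD ?_
    -- With `β = αLf > 0` and `D < 1`, `β² + D < β² + 1 < (1 + β)²`.
    rw [one_div, inv_mul_lt_iff₀ (by positivity)]
    have : 0 < α * Lf := by positivity
    nlinarith
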